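/- An instance of Optimal House Allocation of Agent Network consists of a set $\mathcal A$ of $n$ agents, a (simple, undirected) graph $\mathcal G$ on $\mathcal A$, a set $\mathcal H$ of $m\ge n$ houses, and for every agent $a$ a set $\mathcal P_a\subseteq\mathcal H$ of preferred houses. An allocation is an injective function $\phi:\mathcal A\to\mathcal H$. Agent $a$ envies a neighbour $a'$ under $\phi$ if $\phi(a)\notin\mathcal P_a$ and $\phi(a')\in\mathcal P_a$; the envy of $\phi$ is the number of agents that envy at least one neighbour; and $\phi$ is a minimum-envy allocation if no allocation has smaller envy. **Theorem 3.1.** There is a polynomial-time algorithm that, given any such instance in which every agent prefers exactly one house ($|\mathcal P_a|=1$ for all $a\in\mathcal A$), outputs a minimum-envy allocation. (Polynomial time means: a random access machine with addition and truncated subtraction halts within a number of steps polynomial in the length of a binary word that lists $n$ and $m$ in unary, the adjacency matrix of $\mathcal G$ and the $n\times m$ preference matrix.) Moreover, give each edge $\{a,h\}$ of the complete bipartite graph between $\mathcal A$ and $\mathcal H$ the weight $w(a,h)$, the number of neighbours $a'$ of $a$ in $\mathcal G$ with $\mathcal P_{a'}=\{h\}$, and let the cost of a matching be the sum of the weights of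 its edges. Then for every such instance, and for every allocation $\phi$, the edge set $\{\{a,\phi(a)\}: a\in\mathcal A\}$ is a maximum matching whose cost equals the envy of $\phi$; and a matching is a minimum-cost maximum matching if and only if it is of this form for some minimum-envy allocation $\phi$. -/

import Mathlib

/-! ## A random access machine with a step count

The machine has registers `reg 0, reg 1, …` and arrays `arr 0, arr 1, …`, all holding natural
numbers, with indirect addressing into the arrays.  The only arithmetic is addition and truncated
subtraction (there is deliberately no unit-cost multiplication), so that a computation of `t` steps
only produces numbers with `O(t)` more bits than those it started with. A program is a fixed finite
object, hence mentions finitely many registers and arrays, and each of its steps performs a number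
of elementary operations bounded by a constant of the program. -/

namespace RAM

/-- Contents of the memory. -/
structure Store where
  reg : ℕ → ℕ
  arr : ℕ → ℕ → ℕ

/-- Expressions: literals, registers, array cells, sums and truncated differences. -/
inductive Expr
  | lit (k : ℕ)
  | reg (x : ℕ)
  | cell (a : ℕ) (i : Expr)
  | add (e f : Expr)
  | sub (e f : Expr)

/-- Value of an expression. -/
def Expr.eval (s : Store) : Expr → ℕ
  | .lit k => k
  | .reg x => s.reg x
  | .cell a i => s.arr a (i.eval s)
  | .add e f => e.eval s + f.eval s
  | .sub e f => e.eval s - f.eval s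

/-- Programs. -/
inductive Prog
  | skip
  /-- `reg x := e` -/
  | set (x : ℕ) (e : Expr)
  /-- `arr a [i] := e` -/
  | put (a : ℕ) (i e : Expr)
  /-- first `c`, then `d` -/
  | seq (c d : Prog)
  /-- if `e ≠ 0` then `c`, else `d` -/
  | ite (e : Expr) (c d : Prog)
  /-- while `e ≠ 0` do `c` -/
  | loop (e : Expr) (c : Prog)

/-- A configuration: the programs that remain to be executed, in this order, and the memory.
The machine has halted when nothing remains. -/
structure Config where
  todo : List Prog
  store : Store

/-- One step of the machine (a halted configuration stays as it is). -/
def step : Config → Config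
  | ⟨[], s⟩ => ⟨[], s⟩
  | ⟨.skip :: K, s⟩ => ⟨K, s⟩
  | ⟨.set x e :: K, s⟩ => ⟨K, { s with reg := Function.update s.reg x (e.eval s) }⟩
  | ⟨.put a i e :: K, s⟩ =>
      ⟨K, { s with arr :=
        Function.update s.arr a (Function.update (s.arr a) (i.eval s) (e.eval s)) }⟩
  | ⟨.seq c d :: K, s⟩ => ⟨c :: d :: K, s⟩
  | ⟨.ite e c d :: K, s⟩ => ⟨(if e.eval s ≠ 0 then c else d) :: K, s⟩
  | ⟨.loop e c :: K, s⟩ => ⟨if e.eval s ≠ 0 then c :: .loop e c :: K else K, s⟩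

/-- Initial memory on an input word over `{0,1}`: register `0` holds its length, array `0` holds its
letters, and everything else is `0`. -/
def initStore (w : List Bool) : Store where
  reg := fun x => if x = 0 then w.length else 0
  arr := fun a i => if a = 0 then (w.getD i false).toNat else 0

/-- The output: a list of numbers, of length `reg 0`, read from array `1`. -/
def output (s : Store) : List ℕ :=
  (List.range (s.reg 0)).map (s.arr 1)

/-- Program `c` on the input word `w` halts after at most `T` steps with output `out`. -/
def OutputsWithin (c : Prog) (w : List Bool) (T : ℕ) (out : List ℕ) : Prop :=
  ∃ t ≤ T, ∃ s : Store, step^[t] ⟨[c], initStore w⟩ = ⟨[], s⟩ ∧ output s = out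

/-- The search problem "given (the code of) an instance `x` with `valid x`, output some `out` with
`IsSol x out`" is solved by a polynomial-time algorithm: one program and one polynomial in the
length of the input word work for all valid instances. -/
def PolyTimeSolvable {I : Type*} (code : I → List Bool) (valid : I → Prop)
    (IsSol : I → List ℕ → Prop) : Prop :=
  ∃ (c : Prog) (p : Polynomial ℕ), ∀ x, valid x →
    ∃ out, OutputsWithin c (code x) (p.eval (code x).length) out ∧ IsSol x out

end RAM

/-! ## House allocation on an agent network -/

/-- An instance: agents `Fin n`, houses `Fin m`, the agent graph and the sets of preferred
houses. -/
structure HouseInstance where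
  n : ℕ
  m : ℕ
  graph : SimpleGraph (Fin n)
  pref : Fin n → Finset (Fin m)

namespace HouseInstance

variable (I : HouseInstance)

/-- The allocations: injective functions from agents to houses. -/
abbrev Allocation : Type := Fin I.n ↪ Fin I.m

open Classical in
/-- The neighbours of `a` that `a` envies under `φ`. -/
noncomputable def envied (φ : I.Allocation) (a : Fin I.n) : Finset (Fin I.n) :=
  {a' | I.graph.Adj a a' ∧ φ a ∉ I.pref a ∧ φ a' ∈ I.pref a}

/-- The envy of an allocation: the number of envious agents. -/
noncomputable def envy (φ : I.Allocation) : ℕ :=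
  Finset.card {a : Fin I.n | I.envied φ a ≠ ∅}

/-- `φ` minimizes the number of envious agents among all allocations. -/
def IsMinEnvy (φ : I.Allocation) : Prop :=
  ∀ ψ : I.Allocation, I.envy φ ≤ I.envy ψ

open Classical in
/-- The input word `1ⁿ 0 1ᵐ 0`, followed by the rows of the `n × n` adjacency matrix and then by the
rows of the `n × m` preference matrix. -/
noncomputable def code : List Bool :=
  List.replicate I.n true ++ [false] ++ List.replicate I.m true ++ [false] ++
    ((List.finRange I.n).flatMap fun a =>
      (List.finRange I.n).map fun b => decide (I.graph.Adj a b)) ++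
    ((List.finRange I.n).flatMap fun a =>
      (List.finRange I.m).map fun h => decide (h ∈ I.pref a))

/-- The output lists the houses of the agents `0, 1, …, n - 1` under a minimum-envy allocation. -/
def IsSolution (out : List ℕ) : Prop :=
  ∃ φ : I.Allocation, I.IsMinEnvy φ ∧ out = List.ofFn fun a => (φ a : ℕ)

/-! ### The weighted complete bipartite graph -/

/-- The complete bipartite graph between the agents and the houses. -/
abbrev bip : SimpleGraph (Fin I.n ⊕ Fin I.m) := completeBipartiteGraph (Fin I.n) (Fin I.m)

open Classical in
/-- The weight of the edge `{a, h}`: the number of neighbours of `a` whose unique preferred house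
is `h`. -/
noncomputable def weight (a : Fin I.n) (h : Fin I.m) : ℕ :=
  Finset.card {a' : Fin I.n | I.graph.Adj a a' ∧ I.pref a' = {h}}

open Classical in
/-- The cost of a matching: the sum of the weights of its edges. -/
noncomputable def cost (M : I.bip.Subgraph) : ℕ :=
  ∑ a : Fin I.n, ∑ h : Fin I.m, if M.Adj (.inl a) (.inr h) then I.weight a h else 0

/-- `M` is a matching with the largest possible number of edges. -/
def IsMaxMatching (M : I.bip.Subgraph) : Prop :=
  M.IsMatching ∧ ∀ N : I.bip.Subgraph, N.IsMatching → N.edgeSet.ncard ≤ M.edgeSet.ncard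

/-- `M` has the smallest cost among all maximum matchings. -/
def IsMinCostMaxMatching (M : I.bip.Subgraph) : Prop :=
  I.IsMaxMatching M ∧ ∀ N : I.bip.Subgraph, I.IsMaxMatching N → I.cost M ≤ I.cost N

/-- The subgraph with the edges `{a, φ a}` and their endpoints. -/
def matchingOf (φ : I.Allocation) : I.bip.Subgraph where
  verts := {v | ∃ a, v = .inl a ∨ v = .inr (φ a)}
  Adj u v := ∃ a, (u = .inl a ∧ v = .inr (φ a)) ∨ (u = .inr (φ a) ∧ v = .inl a)
  adj_sub := by
    rintro u v ⟨a, ⟨rfl, rfl⟩ | ⟨rfl, rfl⟩⟩ <;> simp [bip, completeBipartiteGraph]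
  edge_vert := by
    rintro u v ⟨a, ⟨rfl, -⟩ | ⟨rfl, -⟩⟩
    · exact ⟨a, Or.inl rfl⟩
    · exact ⟨a, Or.inr rfl⟩
  symm := ⟨by
    rintro u v ⟨a, ⟨hu, hv⟩ | ⟨hu, hv⟩⟩
    · exact ⟨a, Or.inr ⟨hv, hu⟩⟩
    · exact ⟨a, Or.inl ⟨hv, hu⟩⟩⟩

end HouseInstance

/-! ### Maximum matchings, allocations and the cost of a matching. -/

namespace HouseInstance

variable {I : HouseInstance}

/-! Since `n ≤ m`, a maximum matching covers every agent, so maximum matchings are exactly the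
graphs of allocations (`IsMaxMatching.exists_matchingOf`). The cost of such a matching counts pairs
`(a, a')` of neighbours in which `a` receives the house that `a'` prefers. By injectivity each `a'`
occurs at most once, and exactly when it is envious, so cost equals envy (`sum_weight_eq_envy`).
Minimizing envy is thus an assignment problem.

The assignment problem is solved by an auction with bid increment 1. An agent without a house takes
one minimizing cost plus price, evicts the owner if there is one, and raises the price by 1. Houses
once owned stay owned, so free houses keep price 0. When all agents hold houses, the prices act as a
dual solution and the assignment is optimal up to an error of 1 per agent
(`AuctionState.sum_asg_le`). With costs scaled by `n + 1`, the total error `n` is below the gap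
between distinct cost values, so the result is optimal.

While an agent waits, some house is free. Hence prices never exceed the largest scaled cost `(n + 1)
* n` by more than 1, and as every bid adds 1 to the sum of the prices, there are at most `m * ((n +
1) * n + 1)` bids. The auction is written as a RAM program and verified with time-bounded Hoare
rules; its running time is polynomial in `n` and `m`, which the unary sizes keep below the input
length. -/

theorem matchingOf_adj_inl {φ : I.Allocation} {a : Fin I.n} {v : Fin I.n ⊕ Fin I.m} :
    (I.matchingOf φ).Adj (.inl a) v ↔ v = .inr (φ a) := by
  simp [matchingOf]

theorem matchingOf_adj_inr {φ : I.Allocation} {h : Fin I.m} {v : Fin I.n ⊕ Fin I.m} :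
    (I.matchingOf φ).Adj (.inr h) v ↔ ∃ a, h = φ a ∧ v = .inl a := by
  simp [matchingOf]

theorem matchingOf_isMatching (φ : I.Allocation) : (I.matchingOf φ).IsMatching := by
  rintro v ⟨a, rfl | rfl⟩
  · exact ⟨.inr (φ a), matchingOf_adj_inl.2 rfl, fun _ => matchingOf_adj_inl.1⟩
  · refine ⟨.inl a, matchingOf_adj_inr.2 ⟨a, rfl, rfl⟩, fun w hw => ?_⟩
    obtain ⟨b, hb, rfl⟩ := matchingOf_adj_inr.1 hw
    rw [φ.injective hb]

/-- The matched agents. -/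
def matched (M : I.bip.Subgraph) : Set (Fin I.n) := {a | Sum.inl a ∈ M.verts}

theorem exists_inr_of_adj {M : I.bip.Subgraph} {a : Fin I.n} {v : Fin I.n ⊕ Fin I.m}
    (h : M.Adj (.inl a) v) : ∃ b, v = .inr b := by
  rcases v with b | b
  · simpa [completeBipartiteGraph] using M.adj_sub h
  · exact ⟨b, rfl⟩

theorem exists_inl_of_adj {M : I.bip.Subgraph} {b : Fin I.m} {v : Fin I.n ⊕ Fin I.m}
    (h : M.Adj (.inr b) v) : ∃ a, v = .inl a := by
  rcases v with a | a
  · exact ⟨a, rfl⟩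
  · simpa [completeBipartiteGraph] using M.adj_sub h

/-- Every edge has exactly one agent as an endpoint, and a matched agent lies on exactly one edge.
-/
theorem ncard_edgeSet_eq {M : I.bip.Subgraph} (hM : M.IsMatching) :
    M.edgeSet.ncard = (matched M).ncard := by
  classical
  have hp : ∀ a ∈ matched M, ∃ b, M.Adj (.inl a) (.inr b) := by
    intro a ha
    obtain ⟨w, hw, -⟩ := hM ha
    obtain ⟨b, rfl⟩ := exists_inr_of_adj hw
    exact ⟨b, hw⟩
  choose f hf using hp
  symm
  refine Set.ncard_congr (fun a ha => s(.inl a, .inr (f a ha))) (fun a ha => hf a ha) ?_ ?_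
  · intro a b ha hb h
    exact (by simpa using h : a = b ∧ _).1
  · intro e
    induction e with
    | _ u v =>
      intro h
      have key : ∀ (a : Fin I.n) v, M.Adj (.inl a) v →
          ∃ (b : Fin I.n) (hb : b ∈ matched M),
            s(Sum.inl b, Sum.inr (f b hb)) = s(Sum.inl a, v) := by
        intro a v h
        have ha : a ∈ matched M := M.edge_vert h
        exact ⟨a, ha, by rw [(hM ha).unique h (hf a ha)]⟩
      rcases u with a | b
      · exact key a v h
      · obtain ⟨a, rfl⟩ := exists_inl_of_adj h
        rw [Sym2.eq_swap]
        exact key a _ (M.adj_symm h)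

theorem ncard_edgeSet_matchingOf (φ : I.Allocation) : (I.matchingOf φ).edgeSet.ncard = I.n := by
  rw [ncard_edgeSet_eq (matchingOf_isMatching φ),
    Set.eq_univ_of_forall (s := matched (I.matchingOf φ)) fun a => ⟨a, Or.inl rfl⟩,
    Set.ncard_univ, Nat.card_eq_fintype_card, Fintype.card_fin]

theorem ncard_matched_le (M : I.bip.Subgraph) : (matched M).ncard ≤ I.n := by
  simpa using Set.ncard_le_card (matched M)

theorem matchingOf_isMaxMatching (φ : I.Allocation) : I.IsMaxMatching (I.matchingOf φ) :=
  ⟨matchingOf_isMatching φ, fun N hN => by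
    rw [ncard_edgeSet_matchingOf, ncard_edgeSet_eq hN]
    exact ncard_matched_le N⟩

/-- Comparison with the matching of the inclusion `Fin n ↪ Fin m` forces `M` to have `n` edges,
hence to cover all agents; their partners form an injective function. -/
theorem IsMaxMatching.exists_matchingOf {M : I.bip.Subgraph} (hM : I.IsMaxMatching M)
    (hnm : I.n ≤ I.m) : ∃ φ : I.Allocation, M = I.matchingOf φ := by
  have hcard := hM.2 _ (matchingOf_isMatching (I := I) (Fin.castLEEmb hnm))
  rw [ncard_edgeSet_matchingOf, ncard_edgeSet_eq hM.1] at hcard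
  have hall : matched M = Set.univ :=
    Set.eq_of_subset_of_ncard_le (Set.subset_univ _) (by simpa [Set.ncard_univ] using hcard)
  have hp : ∀ a, ∃ b, M.Adj (.inl a) (.inr b) := by
    intro a
    obtain ⟨w, hw, -⟩ := hM.1 (show a ∈ matched M from hall ▸ Set.mem_univ a)
    obtain ⟨b, rfl⟩ := exists_inr_of_adj hw
    exact ⟨b, hw⟩
  choose f hf using hp
  have hinl : ∀ a v, M.Adj (.inl a) v ↔ v = .inr (f a) := fun a v =>
    ⟨fun h => (hM.1 (M.edge_vert h)).unique h (hf a), fun h => h ▸ hf a⟩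
  have hinj : Function.Injective f := fun a b hab => by
    have hb := M.adj_symm (hf b)
    rw [← hab] at hb
    simpa using (hM.1 (M.edge_vert hb)).unique (M.adj_symm (hf a)) hb
  refine ⟨⟨f, hinj⟩, ?_⟩
  have hadj : ∀ u v, M.Adj u v ↔ (I.matchingOf ⟨f, hinj⟩).Adj u v := by
    rintro (a | b) v
    · rw [hinl, matchingOf_adj_inl]; rfl
    · rw [matchingOf_adj_inr]
      constructor
      · intro h
        obtain ⟨a, rfl⟩ := exists_inl_of_adj h
        exact ⟨a, by simpa using (hinl _ _).1 (M.adj_symm h), rfl⟩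
      · rintro ⟨a, rfl, rfl⟩
        exact M.adj_symm (hf a)
  refine SimpleGraph.Subgraph.ext ?_ (by ext u v; exact hadj u v)
  -- A matching has no isolated vertices, so its adjacency determines its vertex set.
  rw [← hM.1.support_eq_verts, ← (matchingOf_isMatching _).support_eq_verts]
  ext v
  simp only [SimpleGraph.Subgraph.mem_support, hadj]

theorem cost_matchingOf (φ : I.Allocation) :
    I.cost (I.matchingOf φ) = ∑ a, I.weight a (φ a) := by
  simp only [cost, matchingOf_adj_inl, Sum.inr.injEq, Finset.sum_ite_eq', Finset.mem_univ, if_true]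

/-- Double counting: for fixed `a'`, at most one `a` holds the house that `a'` prefers. If such an
`a` is a neighbour, then `a'` cannot hold that house itself, so it is envious. -/
theorem sum_weight_eq_envy (hI : ∀ a, (I.pref a).card = 1) (φ : I.Allocation) :
    ∑ a, I.weight a (φ a) = I.envy φ := by
  classical
  choose p hp using fun a => Finset.card_eq_one.1 (hI a)
  simp only [weight, envy, Finset.card_filter]
  rw [Finset.sum_comm]
  refine Finset.sum_congr rfl fun a' _ => ?_
  rw [← Finset.card_filter]
  simp only [hp, Finset.singleton_inj]
  have henv : I.envied φ a' ≠ ∅ ↔ ∃ a, I.graph.Adj a a' ∧ p a' = φ a := by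
    rw [← Finset.nonempty_iff_ne_empty]
    constructor
    · rintro ⟨a, ha⟩
      simp only [envied, hp, Finset.mem_filter, Finset.mem_singleton] at ha
      exact ⟨a, ha.2.1.symm, ha.2.2.2.symm⟩
    · rintro ⟨a, ha, he⟩
      refine ⟨a, ?_⟩
      simp only [envied, hp, Finset.mem_filter, Finset.mem_singleton]
      exact ⟨Finset.mem_univ _, ha.symm,
        fun h => ha.ne (φ.injective (he.symm.trans h.symm)), he.symm⟩
  split_ifs with h
  · obtain ⟨a, ha, he⟩ := henv.1 h
    rw [Finset.card_eq_one]
    refine ⟨a, ?_⟩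
    ext b
    simp only [Finset.mem_filter, Finset.mem_univ, true_and, Finset.mem_singleton]
    exact ⟨fun hb => φ.injective (hb.2.symm.trans he), fun hb => hb ▸ ⟨ha, he⟩⟩
  · rw [Finset.card_eq_zero, Finset.filter_eq_empty_iff]
    exact fun a _ ha => h (henv.2 ⟨a, ha⟩)

theorem isMinCostMaxMatching_iff (hnm : I.n ≤ I.m) (hI : ∀ a, (I.pref a).card = 1)
    (M : I.bip.Subgraph) :
    I.IsMinCostMaxMatching M ↔ ∃ φ : I.Allocation, I.IsMinEnvy φ ∧ M = I.matchingOf φ := by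
  have hc : ∀ φ : I.Allocation, I.cost (I.matchingOf φ) = I.envy φ := fun φ =>
    (cost_matchingOf φ).trans (sum_weight_eq_envy hI φ)
  constructor
  · rintro ⟨hM, hmin⟩
    obtain ⟨φ, rfl⟩ := hM.exists_matchingOf hnm
    refine ⟨φ, fun ψ => ?_, rfl⟩
    rw [← hc, ← hc]
    exact hmin _ (matchingOf_isMaxMatching ψ)
  · rintro ⟨φ, hφ, rfl⟩
    refine ⟨matchingOf_isMaxMatching φ, fun N hN => ?_⟩
    obtain ⟨ψ, rfl⟩ := hN.exists_matchingOf hnm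
    rw [hc, hc]
    exact hφ ψ

end HouseInstance

/-! ### Hoare rules with time bounds and frame conditions. -/

namespace RAM

/-- The registers that a program may assign. -/
def Prog.regs : Prog → Finset ℕ
  | .skip => ∅
  | .set x _ => {x}
  | .put _ _ _ => ∅
  | .seq c d => c.regs ∪ d.regs
  | .ite _ c d => c.regs ∪ d.regs
  | .loop _ c => c.regs

/-- The arrays that a program may write to. -/
def Prog.arrs : Prog → Finset ℕ
  | .skip => ∅
  | .set _ _ => ∅
  | .put a _ _ => {a}
  | .seq c d => c.arrs ∪ d.arrs
  | .ite _ c d => c.arrs ∪ d.arrs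
  | .loop _ c => c.arrs

/-- The memories `s` and `s'` agree on everything that `c` does not write to. -/
def Prog.Frame (c : Prog) (s s' : Store) : Prop :=
  (∀ x ∉ c.regs, s'.reg x = s.reg x) ∧ ∀ a ∉ c.arrs, s'.arr a = s.arr a

theorem Prog.Frame.refl (c : Prog) (s : Store) : c.Frame s s := ⟨fun _ _ => rfl, fun _ _ => rfl⟩

theorem Prog.Frame.trans {c : Prog} {s₁ s₂ s₃ : Store} (h : c.Frame s₁ s₂) (h' : c.Frame s₂ s₃) :
    c.Frame s₁ s₃ :=
  ⟨fun x hx => (h'.1 x hx).trans (h.1 x hx), fun a ha => (h'.2 a ha).trans (h.2 a ha)⟩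

theorem Prog.Frame.mono {c d : Prog} {s s' : Store} (h : c.Frame s s') (hr : c.regs ⊆ d.regs)
    (ha : c.arrs ⊆ d.arrs) : d.Frame s s' :=
  ⟨fun x hx => h.1 x fun hc => hx (hr hc), fun a hx => h.2 a fun hc => hx (ha hc)⟩

/-- Started in the memory `s`, the program `c` finishes within `T` steps in a memory that satisfies
`Q`, having changed only what it may write to. -/
def Within (c : Prog) (T : ℕ) (s : Store) (Q : Store → Prop) : Prop :=
  ∃ t ≤ T, ∃ s', (∀ K, step^[t] ⟨c :: K, s⟩ = ⟨K, s'⟩) ∧ c.Frame s s' ∧ Q s'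

namespace Within

variable {c d : Prog} {T T' : ℕ} {s : Store} {Q Q' : Store → Prop} {e : Expr}

theorem conseq (h : Within c T s Q) (hT : T ≤ T') (hQ : ∀ s', c.Frame s s' → Q s' → Q' s') :
    Within c T' s Q' := by
  obtain ⟨t, ht, s', hs, hf, hq⟩ := h
  exact ⟨t, ht.trans hT, s', hs, hf, hQ s' hf hq⟩

theorem of_le (h : Within c T s Q) (hT : T ≤ T') : Within c T' s Q :=
  h.conseq hT fun _ _ hq => hq

theorem skip (h : Q s) : Within .skip 1 s Q :=
  ⟨1, le_rfl, s, fun _ => rfl, .refl _ _, h⟩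

theorem set {x : ℕ} (h : Q { s with reg := Function.update s.reg x (e.eval s) }) :
    Within (.set x e) 1 s Q :=
  ⟨1, le_rfl, _, fun _ => rfl,
    ⟨fun y hy => Function.update_of_ne (by simpa [Prog.regs] using hy) _ _, fun _ _ => rfl⟩, h⟩

theorem put {a : ℕ} {i : Expr}
    (h : Q { s with arr :=
      Function.update s.arr a (Function.update (s.arr a) (i.eval s) (e.eval s)) }) :
    Within (.put a i e) 1 s Q :=
  ⟨1, le_rfl, _, fun _ => rfl,
    ⟨fun _ _ => rfl, fun b hb => Function.update_of_ne (by simpa [Prog.arrs] using hb) _ _⟩, h⟩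

/-- The run of `c` is available for every list of remaining programs, in particular for `d :: K`;
the extra step unfolds the sequence. -/
theorem seq (h : Within c T s fun s' => Within d T' s' Q) :
    Within (.seq c d) (T + T' + 1) s Q := by
  obtain ⟨t, ht, s', hs, hf, t', ht', s'', hs', hf', hq⟩ := h
  refine ⟨t' + (t + 1), by omega, s'', fun K => ?_,
    (hf.mono Finset.subset_union_left Finset.subset_union_left).trans
      (hf'.mono Finset.subset_union_right Finset.subset_union_right), hq⟩
  rw [Function.iterate_add_apply, Function.iterate_succ_apply]
  exact (congrArg _ (hs (d :: K))).trans (hs' K)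

theorem ite (hc : e.eval s ≠ 0 → Within c T s Q) (hd : e.eval s = 0 → Within d T s Q) :
    Within (.ite e c d) (T + 1) s Q := by
  by_cases h : e.eval s = 0
  · obtain ⟨t, ht, s', hs, hf, hq⟩ := hd h
    refine ⟨t + 1, by omega, s', fun K => ?_,
      hf.mono Finset.subset_union_right Finset.subset_union_right, hq⟩
    rw [Function.iterate_succ_apply, ← hs K]
    simp [step, h]
  · obtain ⟨t, ht, s', hs, hf, hq⟩ := hc h
    refine ⟨t + 1, by omega, s', fun K => ?_,
      hf.mono Finset.subset_union_left Finset.subset_union_left, hq⟩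
    rw [Function.iterate_succ_apply, ← hs K]
    simp [step, h]

/-- The rule for loops: `J k s` is the invariant, and entails that at most `k` passes remain. -/
theorem loop (J : ℕ → Store → Prop) {k : ℕ} (h₀ : J k s)
    (hJ : ∀ k s', c.Frame s s' → J k s' → e.eval s' ≠ 0 →
      ∃ l, l < k ∧ Within c T s' (J l))
    (hQ : ∀ k s', c.Frame s s' → J k s' → e.eval s' = 0 → Q s') :
    Within (.loop e c) (k * (T + 2) + 1) s Q := by
  have key : ∀ k s₁, c.Frame s s₁ → J k s₁ → Within (.loop e c) (k * (T + 2) + 1) s₁ Q := by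
    intro k
    induction k using Nat.strong_induction_on with
    | _ k ih =>
      intro s₁ hf₁ h₁
      by_cases h : e.eval s₁ = 0
      · exact ⟨1, by omega, s₁, fun K => by simp [step, h], .refl _ _, hQ k s₁ hf₁ h₁ h⟩
      · obtain ⟨l, hl, t, ht, s₂, hs₂, hf₂, h₂⟩ := hJ k s₁ hf₁ h₁ h
        obtain ⟨t', ht', s₃, hs₃, hf₃, h₃⟩ := ih l hl s₂ (hf₁.trans hf₂) h₂
        refine ⟨t' + (t + 1), ?_, s₃, fun K => ?_, Prog.Frame.trans (c := .loop e c) hf₂ hf₃, h₃⟩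
        · have : (l + 1) * (T + 2) ≤ k * (T + 2) := Nat.mul_le_mul_right _ hl
          rw [add_mul] at this
          omega
        · rw [Function.iterate_add_apply, Function.iterate_succ_apply, ← hs₃ K, ← hs₂]
          simp [step, h]
  exact key k s (.refl _ _) h₀

end Within

end RAM

/-! ### The auction, independently of the machine. -/

/-- The state of an auction after some bids: the agents in `A ⊆ {0, …, n - 1}` hold distinct objects
from `{0, …, m - 1}`, `asg a` is the object of `a ∈ A`, `owner h` is `0` if `h` is free and `a + 1`
if `a` holds it. Free objects have price `0`, and what an agent holds minimizes cost plus price for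
this agent up to an error of `1`. -/
structure AuctionState (n m B : ℕ) (C : ℕ → ℕ → ℕ) (asg owner price : ℕ → ℕ) (A : Finset ℕ) :
    Prop where
  lt_of_mem : ∀ a ∈ A, a < n
  asg_lt : ∀ a ∈ A, asg a < m
  owner_asg : ∀ a ∈ A, owner (asg a) = a + 1
  asg_of_owner : ∀ a, ∀ h < m, owner h = a + 1 → a ∈ A ∧ asg a = h
  price_eq_zero : ∀ h < m, owner h = 0 → price h = 0
  slack : ∀ a ∈ A, ∀ h < m, C a (asg a) + price (asg a) ≤ C a h + price h + 1
  price_le : ∀ h < m, price h ≤ B + 1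

namespace AuctionState

variable {n m B : ℕ} {C : ℕ → ℕ → ℕ} {asg owner price : ℕ → ℕ} {A : Finset ℕ}

theorem init {asg owner price : ℕ → ℕ} (ho : ∀ h, owner h = 0) (hp : ∀ h, price h = 0) :
    AuctionState n m B C asg owner price ∅ where
  lt_of_mem := by simp
  asg_lt := by simp
  owner_asg := by simp
  asg_of_owner := by simp [ho]
  price_eq_zero := by simp [hp]
  slack := by simp
  price_le := by simp [hp]

theorem injOn (S : AuctionState n m B C asg owner price A) : Set.InjOn asg A := fun a ha b hb h => by
  have h₁ := S.owner_asg a ha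
  have h₂ := S.owner_asg b hb
  rw [h] at h₁
  omega

/-- If all `m` objects were owned, their owners would be `m ≥ n` agents other than `a`. -/
theorem exists_free (S : AuctionState n m B C asg owner price A) (hnm : n ≤ m) {a : ℕ} (ha : a < n)
    (haA : a ∉ A) : ∃ h < m, owner h = 0 := by
  by_contra! hne
  have hsub : Finset.range m ⊆ A.image asg := fun h hh => by
    have hm := Finset.mem_range.1 hh
    obtain ⟨b, hb⟩ := Nat.exists_eq_succ_of_ne_zero (hne h hm)
    exact Finset.mem_image.2 ⟨b, S.asg_of_owner b h hm hb⟩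
  have h₁ := (Finset.card_le_card hsub).trans Finset.card_image_le
  have h₂ : A ⊂ Finset.range n := by
    rw [Finset.ssubset_iff_of_subset fun b hb => Finset.mem_range.2 (S.lt_of_mem b hb)]
    exact ⟨a, Finset.mem_range.2 ha, haA⟩
  have h₃ := Finset.card_lt_card h₂
  rw [Finset.card_range] at h₁ h₃
  omega

theorem sum_price_le (S : AuctionState n m B C asg owner price A) :
    ∑ h ∈ Finset.range m, price h ≤ m * (B + 1) := by
  simpa using Finset.sum_le_card_nsmul (Finset.range m) price (B + 1)
    fun h hh => S.price_le h (Finset.mem_range.1 hh)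

/-- The free agent `a` takes the best object `h` from its owner and raises its price. -/
theorem bid (S : AuctionState n m B C asg owner price A) (hnm : n ≤ m)
    (hC : ∀ a < n, ∀ h < m, C a h ≤ B) {a h : ℕ} (ha : a < n) (haA : a ∉ A) (hh : h < m)
    (hmin : ∀ h' < m, C a h + price h ≤ C a h' + price h') :
    AuctionState n m B C (Function.update asg a h) (Function.update owner h (a + 1))
      (Function.update price h (price h + 1)) (insert a (A.filter fun b => b + 1 ≠ owner h)) := by
  have hasg : ∀ b ∈ A, b + 1 ≠ owner h → asg b ≠ h := fun b hb hne he =>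
    hne (he ▸ (S.owner_asg b hb).symm)
  refine ⟨?_, ?_, ?_, ?_, ?_, ?_, ?_⟩
  · intro b hb
    rcases Finset.mem_insert.1 hb with rfl | hb
    · exact ha
    · exact S.lt_of_mem b (Finset.mem_filter.1 hb).1
  · intro b hb
    rcases eq_or_ne b a with rfl | hne
    · simpa using hh
    · rw [Function.update_of_ne hne]
      exact S.asg_lt b (Finset.mem_filter.1 (Finset.mem_of_mem_insert_of_ne hb hne)).1
  · intro b hb
    rcases eq_or_ne b a with rfl | hne
    · simp
    · obtain ⟨hbA, hbo⟩ := Finset.mem_filter.1 (Finset.mem_of_mem_insert_of_ne hb hne)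
      rw [Function.update_of_ne hne, Function.update_of_ne (hasg b hbA hbo), S.owner_asg b hbA]
  · intro b h' hh' hb
    rcases eq_or_ne h' h with rfl | hne
    · obtain rfl : a = b := by simpa using hb
      simp
    · rw [Function.update_of_ne hne] at hb
      obtain ⟨hbA, hbh⟩ := S.asg_of_owner b h' hh' hb
      have hba : b ≠ a := fun h => haA (h ▸ hbA)
      rw [Function.update_of_ne hba]
      refine ⟨Finset.mem_insert_of_mem (Finset.mem_filter.2 ⟨hbA, fun ho => hne ?_⟩), hbh⟩
      rw [← hbh, (S.asg_of_owner b h hh ho.symm).2]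
  · intro h' hh' ho
    rcases eq_or_ne h' h with rfl | hne
    · simp at ho
    · rw [Function.update_of_ne hne] at ho ⊢
      exact S.price_eq_zero h' hh' ho
  · intro b hb h' hh'
    -- Prices only rise, and an agent who keeps its object does not hold `h`, so its own price is
    -- unchanged and its slack condition persists. The bidder pays 1 above its best value.
    have hle : price h' ≤ Function.update price h (price h + 1) h' := by
      rw [Function.update_apply]
      split_ifs with he
      · rw [he]; omega
      · exact le_rfl
    rcases eq_or_ne b a with rfl | hne
    · have := hmin h' hh'
      simp only [Function.update_self]
      omega
    · obtain ⟨hbA, hbo⟩ := Finset.mem_filter.1 (Finset.mem_of_mem_insert_of_ne hb hne)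
      have := S.slack b hbA h' hh'
      rw [Function.update_of_ne hne, Function.update_of_ne (hasg b hbA hbo)]
      omega
  · intro h' hh'
    rcases eq_or_ne h' h with rfl | hne
    -- A free object costs at most `B` at price `0`, so the best object had price at most `B` before
    -- the bid.
    · obtain ⟨h₀, hh₀, hfree⟩ := S.exists_free hnm ha haA
      have h₁ := hmin h₀ hh₀
      have h₂ := hC a ha h₀ hh₀
      rw [S.price_eq_zero h₀ hh₀ hfree] at h₁
      simp only [Function.update_self]
      omega
    · rw [Function.update_of_ne hne]
      exact S.price_le h' hh'

/-- The sum of the prices is the potential that, with the cap `sum_price_le`, bounds the number of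
bids. -/
theorem sum_update_price {h : ℕ} (hh : h < m) :
    ∑ x ∈ Finset.range m, Function.update price h (price h + 1) x =
      ∑ x ∈ Finset.range m, price x + 1 := by
  rw [Finset.sum_update_of_mem (Finset.mem_range.2 hh),
    ← Finset.add_sum_erase _ price (Finset.mem_range.2 hh), Finset.sdiff_singleton_eq_erase]
  omega

/-- Weak duality: sum the slack conditions over all agents. Objects outside the image of `asg` have
price `0`, so `asg` collects all the prices, while an injective `ψ` collects at most that. -/
theorem sum_asg_le (S : AuctionState n m B C asg owner price (Finset.range n)) {ψ : ℕ → ℕ}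
    (hψ : ∀ a < n, ψ a < m) (hinj : Set.InjOn ψ (Finset.range n)) :
    ∑ a ∈ Finset.range n, C a (asg a) ≤ ∑ a ∈ Finset.range n, C a (ψ a) + n := by
  have h₁ : ∑ a ∈ Finset.range n, price (asg a) = ∑ h ∈ Finset.range m, price h := by
    rw [← Finset.sum_image S.injOn]
    refine Finset.sum_subset (fun h hh => ?_) fun h hh hne => ?_
    · obtain ⟨a, ha, rfl⟩ := Finset.mem_image.1 hh
      exact Finset.mem_range.2 (S.asg_lt a ha)
    · have hm := Finset.mem_range.1 hh
      refine S.price_eq_zero h hm (by_contra fun ho => hne ?_)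
      obtain ⟨b, hb⟩ := Nat.exists_eq_succ_of_ne_zero ho
      exact Finset.mem_image.2 ⟨b, S.asg_of_owner b h hm hb⟩
  have h₂ : ∑ a ∈ Finset.range n, price (ψ a) ≤ ∑ h ∈ Finset.range m, price h := by
    rw [← Finset.sum_image hinj]
    refine Finset.sum_le_sum_of_subset fun h hh => ?_
    obtain ⟨a, ha, rfl⟩ := Finset.mem_image.1 hh
    exact Finset.mem_range.2 (hψ a (Finset.mem_range.1 ha))
  have h₃ := Finset.sum_le_sum fun a (ha : a ∈ Finset.range n) =>
    S.slack a ha (ψ a) (hψ a (Finset.mem_range.1 ha))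
  simp only [Finset.sum_add_distrib, Finset.sum_const, Finset.card_range, smul_eq_mul,
    mul_one] at h₃
  omega

/-- When all agents hold an object and the costs are multiples of `n + 1`, the error terms vanish. -/
theorem sum_asg_le_of_scaled {w : ℕ → ℕ → ℕ}
    (S : AuctionState n m B (fun a h => (n + 1) * w a h) asg owner price (Finset.range n))
    {ψ : ℕ → ℕ} (hψ : ∀ a < n, ψ a < m) (hinj : Set.InjOn ψ (Finset.range n)) :
    ∑ a ∈ Finset.range n, w a (asg a) ≤ ∑ a ∈ Finset.range n, w a (ψ a) := by
  have h := S.sum_asg_le hψ hinj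
  rw [← Finset.mul_sum, ← Finset.mul_sum] at h
  by_contra! hlt
  -- A strictly cheaper `ψ` would be cheaper by at least `n + 1` after scaling, more than the total
  -- error `n`.
  have := Nat.mul_le_mul_left (n + 1) (Nat.succ_le_of_lt hlt)
  rw [Nat.succ_eq_add_one, mul_add] at this
  omega

end AuctionState

/-! ### Counting loops. -/

namespace RAM

/-- A counting loop: `reg x` runs from `0` to `n = reg N`, and `J i` holds when it has value `i`. -/
theorem Within.forLoop {c : Prog} {T : ℕ} {s : Store} {N x n : ℕ} (J : ℕ → Store → Prop)
    (hN : s.reg N = n) (hNc : N ∉ c.regs) (hx : s.reg x = 0) (h₀ : J 0 s)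
    (hJ : ∀ i < n, ∀ s', c.Frame s s' → s'.reg x = i → J i s' →
      Within c T s' fun s'' => s''.reg x = i + 1 ∧ J (i + 1) s'') :
    Within (.loop (.sub (.reg N) (.reg x)) c) (n * (T + 2) + 1) s (J n) := by
  refine Within.loop (fun k s' => s'.reg x + k = n ∧ J (s'.reg x) s') ⟨by omega, hx ▸ h₀⟩ ?_ ?_
  · rintro k s' hf ⟨hk, hj⟩ he
    have hN' : s'.reg N = n := (hf.1 N hNc).trans hN
    simp only [Expr.eval, hN'] at he
    refine ⟨k - 1, by omega, (hJ _ (by omega) s' hf rfl hj).conseq le_rfl ?_⟩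
    rintro s'' - ⟨h, hj'⟩
    exact ⟨by omega, h ▸ hj'⟩
  · rintro k s' hf ⟨hk, hj⟩ he
    have hN' : s'.reg N = n := (hf.1 N hNc).trans hN
    simp only [Expr.eval, hN'] at he
    obtain rfl : s'.reg x = n := by omega
    exact hj

/-- Add one to a register. -/
def incr (x : ℕ) : Prog := .set x (.add (.reg x) (.lit 1))

end RAM

/-! ### The program and its verification. -/

namespace HouseProgram

open RAM

/-- The memory content `x` starts with `1ⁿ 0 1ᵐ 0`, an `n × n` matrix and the `n × m` matrix of the
function `p`. -/
structure Encodes (n m : ℕ) (p x : ℕ → ℕ) : Prop where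
  ne_zero_of_lt : ∀ i < n, x i ≠ 0
  eq_zero : x n = 0
  ne_zero_of_lt' : ∀ j < m, x (n + j + 1) ≠ 0
  eq_zero' : x (n + m + 1) = 0
  lt_m : ∀ b < n, p b < m
  pref_iff : ∀ b < n, ∀ h < m, x (n + m + 2 + n * n + b * m + h) ≠ 0 ↔ h = p b

/-- The number of neighbours of `a` that prefer `h`. -/
def demand (n m : ℕ) (p x : ℕ → ℕ) (a h : ℕ) : ℕ :=
  Finset.card {b ∈ Finset.range n | x (n + m + 2 + a * n + b) ≠ 0 ∧ p b = h}

theorem demand_le (n m : ℕ) (p x : ℕ → ℕ) (a h : ℕ) : demand n m p x a h ≤ n :=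
  (Finset.card_filter_le _ _).trans (Finset.card_range n).le

/-- The memory holds the input, the sizes, the row starts of the adjacency matrix and the preferred
houses. -/
structure Loaded (n m : ℕ) (p x : ℕ → ℕ) (s : Store) : Prop where
  reg_one : s.reg 1 = n
  reg_two : s.reg 2 = m
  input : s.arr 0 = x
  row : ∀ a < n, s.arr 2 a = n + m + 2 + a * n
  pref : ∀ b < n, s.arr 3 b = p b

variable {n m : ℕ} {p x : ℕ → ℕ} {s : Store}

theorem Loaded.frame {c : Prog} {s' : Store} (h : Loaded n m p x s) (hf : c.Frame s s')
    (h₁ : 1 ∉ c.regs) (h₂ : 2 ∉ c.regs) (h₃ : 0 ∉ c.arrs) (h₄ : 2 ∉ c.arrs) (h₅ : 3 ∉ c.arrs) :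
    Loaded n m p x s' where
  reg_one := (hf.1 1 h₁).trans h.reg_one
  reg_two := (hf.1 2 h₂).trans h.reg_two
  input := (hf.2 0 h₃).trans h.input
  row := (hf.2 2 h₄).symm ▸ h.row
  pref := (hf.2 3 h₅).symm ▸ h.pref

/-! ### Reading the input -/

/-- Read the sizes `n` and `m` into registers `1` and `2`. -/
def readSizes : Prog :=
  .seq (.loop (.cell 0 (.reg 1)) (incr 1))
    (.loop (.cell 0 (.add (.add (.reg 1) (.reg 2)) (.lit 1))) (incr 2))

/-- Each loop scans a unary block up to its terminating zero, and the invariant counts the letters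
left in the block. -/
theorem within_readSizes (hx : Encodes n m p x) (h₁ : s.reg 1 = 0) (h₂ : s.reg 2 = 0)
    (h₀ : s.arr 0 = x) :
    Within readSizes (3 * n + 3 * m + 3) s fun s' => s'.reg 1 = n ∧ s'.reg 2 = m := by
  refine (Within.seq (T := n * (1 + 2) + 1) (T' := m * (1 + 2) + 1) ?_).of_le (by omega)
  refine Within.loop (fun k s' => s'.reg 1 + k = n) (by omega) ?_ ?_
  · intro k s' hf hk he
    have h₀' : s'.arr 0 = x := (hf.2 0 (by decide)).trans h₀
    simp only [Expr.eval, h₀'] at he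
    have : s'.reg 1 ≠ n := fun h => he (h ▸ hx.eq_zero)
    exact ⟨k - 1, by omega, Within.set (by simp [Expr.eval]; omega)⟩
  · intro k s' hf hk he
    have h₀' : s'.arr 0 = x := (hf.2 0 (by decide)).trans h₀
    simp only [Expr.eval, h₀'] at he
    have h₁' : s'.reg 1 = n := by
      by_contra hne
      exact hx.ne_zero_of_lt _ (by omega) he
    have h₂' : s'.reg 2 = 0 := (hf.1 2 (by decide)).trans h₂
    refine Within.loop (fun k s' => s'.reg 2 + k = m) (by omega) ?_ ?_
    · intro k s'' hf' hk' he'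
      rw [show Expr.eval s'' _ = x (n + s''.reg 2 + 1) by
        simp [Expr.eval, hf'.2 0 (by decide), hf'.1 1 (by decide), h₀', h₁']] at he'
      have : s''.reg 2 ≠ m := fun h => he' (h ▸ hx.eq_zero')
      exact ⟨k - 1, by omega, Within.set (by simp [Expr.eval]; omega)⟩
    · intro k s'' hf' hk' he'
      rw [show Expr.eval s'' _ = x (n + s''.reg 2 + 1) by
        simp [Expr.eval, hf'.2 0 (by decide), hf'.1 1 (by decide), h₀', h₁']] at he'
      refine ⟨(hf'.1 1 (by decide)).trans h₁', ?_⟩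
      by_contra hne
      exact hx.ne_zero_of_lt' _ (by omega) he'

/-- Store the row starts of the adjacency matrix in array `2`; register `3` ends up as the start of
the preference matrix. -/
def readRows : Prog :=
  .seq (.set 3 (.add (.add (.reg 1) (.reg 2)) (.lit 2)))
    (.loop (.sub (.reg 1) (.reg 4))
      (.seq (.put 2 (.reg 4) (.reg 3)) (.seq (.set 3 (.add (.reg 3) (.reg 1))) (incr 4))))

/-- Repeated addition of `n` replaces the multiplication that the machine does not have. -/
theorem within_readRows (h₁ : s.reg 1 = n) (h₂ : s.reg 2 = m) (h₄ : s.reg 4 = 0) :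
    Within readRows (7 * n + 3) s fun s' =>
      s'.reg 3 = n + m + 2 + n * n ∧ ∀ a < n, s'.arr 2 a = n + m + 2 + a * n := by
  refine (Within.seq (T' := n * (5 + 2) + 1) (Within.set ?_)).of_le (by omega)
  refine Within.forLoop (n := n) (T := 5) (fun i s' => s'.reg 3 = n + m + 2 + i * n ∧
    ∀ a < i, s'.arr 2 a = n + m + 2 + a * n) (by simpa using h₁) (by decide) (by simpa using h₄)
    (by simp [Expr.eval, h₁, h₂]) ?_
  rintro i hi s' hf h4 ⟨h3, ha⟩
  have h1 : s'.reg 1 = n := by rw [hf.1 1 (by decide)]; simpa using h₁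
  refine Within.seq (Within.put (Within.seq (Within.set (Within.set ?_))))
  simp only [Expr.eval, Function.update_apply, h4, h3, h1]
  refine ⟨by simp, by simp; ring, fun a hai => ?_⟩
  by_cases h : a = i
  · simp [h]
  · simpa [h] using ha a (by omega)

/-- Store the preferred house of each agent in array `3`. -/
def readPrefs : Prog :=
  .loop (.sub (.reg 1) (.reg 10))
    (.seq (.set 5 (.lit 0))
      (.seq (.loop (.sub (.lit 1) (.cell 0 (.add (.reg 3) (.reg 5)))) (incr 5))
        (.seq (.put 3 (.reg 10) (.reg 5)) (.seq (.set 3 (.add (.reg 3) (.reg 2))) (incr 10)))))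

theorem within_readPrefs (hx : Encodes n m p x) (h₁ : s.reg 1 = n) (h₂ : s.reg 2 = m)
    (h₃ : s.reg 3 = n + m + 2 + n * n) (h₁₀ : s.reg 10 = 0) (h₀ : s.arr 0 = x) :
    Within readPrefs (n * (3 * m + 11) + 1) s fun s' => ∀ b < n, s'.arr 3 b = p b := by
  refine (Within.forLoop (n := n) (T := 3 * m + 9) (fun i s' =>
    s'.reg 3 = n + m + 2 + n * n + i * m ∧ ∀ b < i, s'.arr 3 b = p b) h₁ (by decide) h₁₀
    (by simp [h₃]) ?_).conseq le_rfl fun s' _ h => h.2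
  rintro i hi s' hf h10 ⟨h3, hp⟩
  have h2 : s'.reg 2 = m := (hf.1 2 (by decide)).trans h₂
  have h0 : s'.arr 0 = x := (hf.2 0 (by decide)).trans h₀
  have hpm := hx.lt_m i hi
  refine (Within.seq (Within.set (Within.seq (T := p i * (1 + 2) + 1) (T' := 5) ?_))).of_le
    (by omega)
  -- The test `1 - cell` is nonzero exactly when the cell is `0`, so the scan of row `i` stops at
  -- its only nonzero entry, `p i`.
  refine Within.loop (fun k s' => s'.reg 5 + k = p i) (by simp [Expr.eval]) ?_ ?_
  · intro k s'' hf' hk he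
    have hv : Expr.eval s'' (.cell 0 (.add (.reg 3) (.reg 5))) =
        x (n + m + 2 + n * n + i * m + s''.reg 5) := by
      simp [Expr.eval, hf'.2 0 (by decide), hf'.1 3 (by decide), h0, h3]
    rw [Expr.eval, hv, Expr.eval] at he
    have hne : s''.reg 5 ≠ p i := fun h => by
      have := (hx.pref_iff i hi (s''.reg 5) (by omega)).2 h
      omega
    exact ⟨k - 1, by omega, Within.set (by simp [Expr.eval]; omega)⟩
  · intro k s'' hf' hk he
    have hv : Expr.eval s'' (.cell 0 (.add (.reg 3) (.reg 5))) =
        x (n + m + 2 + n * n + i * m + s''.reg 5) := by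
      simp [Expr.eval, hf'.2 0 (by decide), hf'.1 3 (by decide), h0, h3]
    rw [Expr.eval, hv, Expr.eval] at he
    have h5 : s''.reg 5 = p i := (hx.pref_iff i hi (s''.reg 5) (by omega)).1 (by omega)
    have h10' : s''.reg 10 = i := by rw [hf'.1 10 (by decide)]; simpa using h10
    have h3' : s''.reg 3 = n + m + 2 + n * n + i * m := by
      rw [hf'.1 3 (by decide)]; simpa using h3
    have h2' : s''.reg 2 = m := by rw [hf'.1 2 (by decide)]; simpa using h2
    have ha3 : s''.arr 3 = s'.arr 3 := by rw [hf'.2 3 (by decide)]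
    refine Within.seq (Within.put (Within.seq (Within.set (Within.set ?_))))
    simp only [Expr.eval, Function.update_apply, h10', h5, h3', h2', ha3]
    refine ⟨by simp, by simp; ring, fun b hb => ?_⟩
    by_cases h : b = i
    · simp [h]
    · simpa [h] using hp b (by omega)

/-! ### A bid -/

/-- Compute the scaled cost plus price of all houses for the agent `reg 6 - 1` in array `6`. -/
def score : Prog :=
  .seq (.set 5 (.lit 0))
    (.seq (.loop (.sub (.reg 2) (.reg 5)) (.seq (.put 6 (.reg 5) (.cell 4 (.reg 5))) (incr 5)))
      (.seq (.set 5 (.lit 0))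
        (.loop (.sub (.reg 1) (.reg 5))
          (.seq (.ite (.cell 0 (.add (.cell 2 (.sub (.reg 6) (.lit 1))) (.reg 5)))
              (.put 6 (.cell 3 (.reg 5)) (.add (.cell 6 (.cell 3 (.reg 5)))
                (.add (.reg 1) (.lit 1)))) .skip)
            (incr 5)))))

/-- Starting from a copy of the prices, each neighbour of `a` adds `n + 1` to the score of its
preferred house. All scores thus arise in linear time, without multiplication. -/
theorem within_score (h : Loaded n m p x s) {a : ℕ} (ha : a < n)
    (h₆ : s.reg 6 = a + 1) :
    Within score (5 * m + 6 * n + 7) s fun s' =>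
      ∀ h < m, s'.arr 6 h = (n + 1) * demand n m p x a h + s.arr 4 h := by
  refine (Within.seq (Within.set (Within.seq (T := m * (3 + 2) + 1) (T' := n * (4 + 2) + 3)
    ?_))).of_le (by omega)
  refine (Within.forLoop (n := m) (fun i s' => ∀ h < i, s'.arr 6 h = s.arr 4 h)
    (by simpa using h.reg_two) (by decide) (by simp [Expr.eval]) (by simp) ?_).conseq le_rfl
    fun s₁ hf₁ hs₁ => ?_
  · intro i _ s' hf h5 hi
    refine Within.seq (Within.put (Within.set ?_))
    have h4 : s'.arr 4 = s.arr 4 := by rw [hf.2 4 (by decide)]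
    simp only [Expr.eval, Function.update_apply, h5, h4]
    refine ⟨by simp, fun h hh => ?_⟩
    by_cases he : h = i
    · simp [he]
    · simpa [he] using hi h (by omega)
  have l₁ : Loaded n m p x s₁ :=
    Loaded.frame (s := { s with reg := Function.update s.reg 5 0 })
      ⟨h.reg_one, h.reg_two, h.input, h.row, h.pref⟩ hf₁
      (by decide) (by decide) (by decide) (by decide) (by decide)
  have h₆' : s₁.reg 6 = a + 1 := by rw [hf₁.1 6 (by decide)]; simpa using h₆
  refine (Within.seq (T' := n * (4 + 2) + 1) (Within.set ?_)).of_le (by omega)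
  refine (Within.forLoop (n := n) (fun i s' => ∀ h < m, s'.arr 6 h = (n + 1) *
    Finset.card {b ∈ Finset.range i | x (n + m + 2 + a * n + b) ≠ 0 ∧ p b = h} + s.arr 4 h)
    (by simpa using l₁.reg_one) (by decide) (by simp [Expr.eval]) (by simpa using hs₁) ?_)
  intro i hi s' hf h5 hJ
  have h0 : s'.arr 0 = x := by rw [hf.2 0 (by decide)]; exact l₁.input
  have h2 : s'.arr 2 a = n + m + 2 + a * n := by rw [hf.2 2 (by decide)]; exact l₁.row a ha
  have h3 : s'.arr 3 i = p i := by rw [hf.2 3 (by decide)]; exact l₁.pref i hi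
  have h1 : s'.reg 1 = n := by rw [hf.1 1 (by decide)]; simpa using l₁.reg_one
  have h6 : s'.reg 6 = a + 1 := by rw [hf.1 6 (by decide)]; simpa using h₆'
  refine Within.seq (T := 2) (Within.ite (fun he => Within.put (Within.set ?_))
    fun he => Within.skip (Within.set ?_))
  · simp only [Expr.eval, h0, h6, h5, Nat.add_sub_cancel, h2] at he
    simp only [Expr.eval, h5, h3, h1]
    refine ⟨by simp, fun h hh => ?_⟩
    rw [Finset.range_add_one, Finset.filter_insert]
    by_cases hp : h = p i
    · subst hp
      rw [if_pos ⟨he, rfl⟩, Finset.card_insert_of_notMem (by simp)]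
      simp only [Function.update_self, hJ _ hh]
      ring
    · rw [if_neg (by tauto)]
      simpa [hp] using hJ h hh
  · simp only [Expr.eval, h0, h6, h5, Nat.add_sub_cancel, h2] at he
    simp only [Expr.eval, h5]
    refine ⟨by simp, fun h hh => ?_⟩
    rw [Finset.range_add_one, Finset.filter_insert, if_neg (by tauto)]
    exact hJ h hh

/-- Find the position of a minimum of array `6` below `reg 2`. -/
def argmin : Prog :=
  .seq (.set 5 (.lit 0)) (.seq (.set 7 (.lit 0))
    (.loop (.sub (.reg 2) (.reg 5))
      (.seq (.ite (.sub (.cell 6 (.reg 7)) (.cell 6 (.reg 5))) (.set 7 (.reg 5)) .skip)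
        (incr 5))))

theorem within_argmin (h₂ : s.reg 2 = m) (hm : 0 < m) :
    Within argmin (6 * m + 5) s fun s' =>
      s'.reg 7 < m ∧ ∀ h < m, s.arr 6 (s'.reg 7) ≤ s.arr 6 h := by
  refine (Within.seq (Within.set (Within.seq (T' := m * (4 + 2) + 1) (Within.set ?_)))).of_le
    (by omega)
  refine Within.forLoop (n := m) (fun i s' =>
    s'.reg 7 < m ∧ ∀ h < i, s.arr 6 (s'.reg 7) ≤ s.arr 6 h)
    (by simpa using h₂) (by decide) (by simp [Expr.eval]) (by simpa [Expr.eval] using hm) ?_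
  rintro i hi s' hf h5 ⟨h7, hJ⟩
  have h6 : s'.arr 6 = s.arr 6 := by rw [hf.2 6 (by decide)]
  refine Within.seq (T := 2) (Within.ite (fun he => Within.set (Within.set ?_))
    fun he => Within.skip (Within.set ?_))
  · simp only [Expr.eval, h6, h5] at he
    simp only [Expr.eval, h5]
    refine ⟨by simp [h5], by simpa using hi, fun h hh => ?_⟩
    rw [show Function.update (Function.update s'.reg 7 i) 5 _ 7 = i from rfl]
    rcases Nat.lt_succ_iff_lt_or_eq.1 hh with hlt | rfl
    · have := hJ h hlt
      omega
    · exact le_rfl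
  · simp only [Expr.eval, h6, h5] at he
    simp only [Expr.eval, h5]
    refine ⟨by simp, by simpa using h7, fun h hh => ?_⟩
    rw [show Function.update s'.reg 5 _ 7 = s'.reg 7 from rfl]
    rcases Nat.lt_succ_iff_lt_or_eq.1 hh with hlt | rfl
    · exact hJ h hlt
    · omega

/-- If all agents below `reg 8` hold a house, let agent `reg 8` be the next to bid. -/
def activate : Prog :=
  .ite (.sub (.reg 1) (.reg 8)) (.set 6 (.add (.reg 8) (.lit 1))) (.set 6 (.lit 0))

/-- `A` is the set of agents that hold a house, when the agents `0, …, i` have been activated and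
the agent `cur - 1` is about to bid, or all agents hold a house and `cur = 0`. -/
def Pending (n i cur : ℕ) (A : Finset ℕ) : Prop :=
  (cur = 0 → A = Finset.range n) ∧
    (cur ≠ 0 → i < n ∧ cur ≤ i + 1 ∧ ∀ b, b ∈ A ↔ b ≤ i ∧ b + 1 ≠ cur)

theorem within_activate (h₁ : s.reg 1 = n) (h₈ : s.reg 8 ≤ n) {Q : Store → Prop}
    (hQ : ∀ cur, Pending n (s.reg 8) cur (Finset.range (s.reg 8)) →
      Q { s with reg := Function.update s.reg 6 cur }) : Within activate 2 s Q := by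
  refine Within.ite (fun he => Within.set (hQ _ ?_)) fun he => Within.set (hQ _ ?_)
  · simp only [Expr.eval, h₁] at he
    refine ⟨by simp [Expr.eval], fun _ => ⟨by omega, le_rfl, fun b => ?_⟩⟩
    simp only [Finset.mem_range, Expr.eval]
    omega
  · simp only [Expr.eval, h₁] at he
    refine ⟨fun _ => ?_, by simp [Expr.eval]⟩
    rw [show s.reg 8 = n by omega]

/-- Give the house `reg 7` to the agent `reg 6 - 1` and raise its price; register `9` keeps the
previous owner. -/
def award : Prog :=
  .seq (.set 9 (.cell 5 (.reg 7)))
    (.seq (.put 1 (.sub (.reg 6) (.lit 1)) (.reg 7))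
      (.seq (.put 5 (.reg 7) (.reg 6)) (.put 4 (.reg 7) (.add (.cell 4 (.reg 7)) (.lit 1)))))

theorem within_award {a g : ℕ} (h₆ : s.reg 6 = a + 1) (h₇ : s.reg 7 = g) :
    Within award 7 s fun s' => s'.reg 9 = s.arr 5 g ∧
      s'.arr 1 = Function.update (s.arr 1) a g ∧
      s'.arr 5 = Function.update (s.arr 5) g (a + 1) ∧
      s'.arr 4 = Function.update (s.arr 4) g (s.arr 4 g + 1) := by
  refine Within.seq (Within.set (Within.seq (Within.put (Within.seq (Within.put
    (Within.put ?_))))))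
  simp [Expr.eval, h₆, h₇]

/-- One bid of the agent `reg 6 - 1`; the next to bid is the evicted agent or a new one. -/
def bid : Prog :=
  .seq score (.seq argmin (.seq award
    (.ite (.reg 9) (.set 6 (.reg 9)) (.seq (incr 8) activate))))

/-- The scaled costs for the auction. -/
def scaledCost (n m : ℕ) (p x : ℕ → ℕ) (a h : ℕ) : ℕ := (n + 1) * demand n m p x a h

/-- The invariant of the auction; `k` bounds the number of bids to come. -/
def AuctionInvariant (n m : ℕ) (p x : ℕ → ℕ) (k : ℕ) (s : Store) : Prop :=
  ∃ A, AuctionState n m ((n + 1) * n) (scaledCost n m p x) (s.arr 1) (s.arr 5) (s.arr 4) A ∧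
    Pending n (s.reg 8) (s.reg 6) A ∧
    ∑ h ∈ Finset.range m, s.arr 4 h + k = m * ((n + 1) * n + 1)

/-- One pass realizes `AuctionState.bid` and spends one unit of the remaining price budget `k`. -/
theorem within_bid (hnm : n ≤ m) (h : Loaded n m p x s) {k : ℕ} (hJ : AuctionInvariant n m p x k s)
    (h₆ : s.reg 6 ≠ 0) :
    ∃ l, l < k ∧ Within bid (11 * m + 6 * n + 27) s (AuctionInvariant n m p x l) := by
  obtain ⟨A, hS, hP, hk⟩ := hJ
  obtain ⟨a, ha⟩ := Nat.exists_eq_succ_of_ne_zero h₆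
  obtain ⟨hin, hcur, hA⟩ := hP.2 h₆
  have han : a < n := by omega
  have haA : a ∉ A := fun h => ((hA a).1 h).2 ha.symm
  have hC : ∀ a < n, ∀ h < m, scaledCost n m p x a h ≤ (n + 1) * n := fun a _ h _ =>
    Nat.mul_le_mul_left _ (demand_le n m p x a h)
  have hbid := fun h hh hmin => hS.bid hnm hC han haA (h := h) hh hmin
  -- With `k = 0` the price sum is already at its cap, which one more bid would exceed.
  have hk0 : k ≠ 0 := by
    rintro rfl
    obtain ⟨h, hh, hmin⟩ := (Finset.range m).exists_min_image
      (fun h => scaledCost n m p x a h + s.arr 4 h) ⟨0, Finset.mem_range.2 (by omega)⟩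
    have hm := Finset.mem_range.1 hh
    have h₁ := (hbid h hm fun h' hh' => hmin h' (Finset.mem_range.2 hh')).sum_price_le
    rw [AuctionState.sum_update_price hm] at h₁
    omega
  refine ⟨k - 1, by omega, ?_⟩
  refine (Within.seq (T := 5 * m + 6 * n + 7) (T' := 6 * m + 19) ?_).of_le (by omega)
  refine (within_score h han ha).conseq le_rfl fun s₁ hf₁ hs₁ => ?_
  have l₁ := h.frame hf₁ (by decide) (by decide) (by decide) (by decide) (by decide)
  refine (Within.seq (T := 6 * m + 5) (T' := 13) ?_).of_le (by omega)
  refine (within_argmin l₁.reg_two (by omega)).conseq le_rfl fun s₂ hf₂ hs₂ => ?_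
  have l₂ := l₁.frame hf₂ (by decide) (by decide) (by decide) (by decide) (by decide)
  obtain ⟨hm, hmin⟩ := hs₂
  have e1 : s₂.arr 1 = s.arr 1 := (hf₂.2 1 (by decide)).trans (hf₁.2 1 (by decide))
  have e4 : s₂.arr 4 = s.arr 4 := (hf₂.2 4 (by decide)).trans (hf₁.2 4 (by decide))
  have e5 : s₂.arr 5 = s.arr 5 := (hf₂.2 5 (by decide)).trans (hf₁.2 5 (by decide))
  have e6 : s₂.reg 6 = a + 1 := ((hf₂.1 6 (by decide)).trans (hf₁.1 6 (by decide))).trans ha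
  have e8 : s₂.reg 8 = s.reg 8 := (hf₂.1 8 (by decide)).trans (hf₁.1 8 (by decide))
  generalize hg : s₂.reg 7 = g at hm hmin
  have hS' := hbid g hm fun h' hh' => by
    have := hmin h' hh'
    rwa [hs₁ _ hm, hs₁ _ hh'] at this
  have hsum : ∑ h ∈ Finset.range m, Function.update (s.arr 4) g (s.arr 4 g + 1) h + (k - 1) =
      m * ((n + 1) * n + 1) := by
    rw [AuctionState.sum_update_price hm]
    omega
  -- After the bid, the only activated agent without a house is the evicted one, if any.
  have hA' : ∀ b, b ∈ insert a (A.filter fun b => b + 1 ≠ s.arr 5 g) ↔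
      b ≤ s.reg 8 ∧ b + 1 ≠ s.arr 5 g := by
    intro b
    have hao : a + 1 ≠ s.arr 5 g := fun ho => haA (hS.asg_of_owner a g hm ho.symm).1
    simp only [Finset.mem_insert, Finset.mem_filter, hA]
    constructor
    · rintro (rfl | hb)
      · exact ⟨by omega, hao⟩
      · exact ⟨hb.1.1, hb.2⟩
    · intro hb
      by_cases hba : b = a
      · exact Or.inl hba
      · exact Or.inr ⟨⟨hb.1, by omega⟩, hb.2⟩
  refine Within.seq (T' := 5) ((within_award e6 hg).conseq le_rfl fun s₃ hf₃ hs₃ => ?_)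
  have l₃ := l₂.frame hf₃ (by decide) (by decide) (by decide) (by decide) (by decide)
  obtain ⟨r9, r1, r5, r4⟩ := hs₃
  have r8 : s₃.reg 8 = s.reg 8 := (hf₃.1 8 (by decide)).trans e8
  rw [e5] at r9 r5
  rw [e1] at r1
  rw [e4] at r4
  rw [← r1, ← r5, ← r4, ← r9] at hS'
  rw [← r9] at hA'
  rw [← r4] at hsum
  refine Within.ite (T := 4) (fun he => ?_) fun he => ?_
  · replace he : s₃.reg 9 ≠ 0 := he
    have ho := (hS.asg_of_owner (s₃.reg 9 - 1) g hm (by omega)).1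
    rw [hA] at ho
    exact (Within.set ⟨_, hS', ⟨fun h => absurd h he, fun _ => ⟨r8.trans_lt hin,
      by simp [Expr.eval, r8]; omega, fun b => (hA' b).trans (by simp [Expr.eval, r8])⟩⟩,
      hsum⟩).of_le (by omega)
  · replace he : s₃.reg 9 = 0 := he
    refine Within.seq (Within.set (within_activate (n := n) (by exact l₃.reg_one) ?_ fun cur hcur => ?_))
    · simp [Expr.eval, r8]
      omega
    · refine ⟨_, hS', ?_, hsum⟩
      -- The house was free: nobody is evicted, so all activated agents hold houses and the next one
      -- may enter.
      rw [show insert a (A.filter fun b => b + 1 ≠ s₃.reg 9) = Finset.range (s₃.reg 8 + 1) by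
        ext b
        rw [hA', Finset.mem_range, he, r8]
        omega]
      exact hcur

/-! ### The whole program -/

/-- Read the whole input. -/
def load : Prog := .seq readSizes (.seq readRows readPrefs)

theorem within_load (hx : Encodes n m p x) (hr : ∀ r, r ≠ 0 → s.reg r = 0) (h₀ : s.arr 0 = x) :
    Within load (10 * n + 3 * m + n * (3 * m + 11) + 9) s (Loaded n m p x) := by
  refine (Within.seq (T := 3 * n + 3 * m + 3) (T' := 7 * n + n * (3 * m + 11) + 5) ?_).of_le
    (by omega)
  refine (within_readSizes hx (hr 1 (by decide)) (hr 2 (by decide)) h₀).conseq le_rfl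
    fun s₁ hf₁ hs₁ => ?_
  have h₄ : s₁.reg 4 = 0 := (hf₁.1 4 (by decide)).trans (hr 4 (by decide))
  refine (Within.seq (T := 7 * n + 3) (T' := n * (3 * m + 11) + 1) ?_).of_le (by omega)
  refine (within_readRows hs₁.1 hs₁.2 h₄).conseq le_rfl fun s₂ hf₂ hs₂ => ?_
  have n₂ : s₂.reg 1 = n := (hf₂.1 1 (by decide)).trans hs₁.1
  have m₂ : s₂.reg 2 = m := (hf₂.1 2 (by decide)).trans hs₁.2
  have x₂ : s₂.arr 0 = x := (hf₂.2 0 (by decide)).trans ((hf₁.2 0 (by decide)).trans h₀)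
  have h₁₀ : s₂.reg 10 = 0 :=
    (hf₂.1 10 (by decide)).trans ((hf₁.1 10 (by decide)).trans (hr 10 (by decide)))
  refine (within_readPrefs hx n₂ m₂ hs₂.1 h₁₀ x₂).conseq le_rfl fun s₃ hf₃ hs₃ => ?_
  exact {
    reg_one := (hf₃.1 1 (by decide)).trans n₂
    reg_two := (hf₃.1 2 (by decide)).trans m₂
    input := (hf₃.2 0 (by decide)).trans x₂
    row := fun a ha => by rw [hf₃.2 2 (by decide)]; exact hs₂.2 a ha
    pref := hs₃ }

/-- Let the agents bid until each of them holds a house. -/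
def auction : Prog := .seq activate (.loop (.reg 6) bid)

/-- A time bound for the auction. -/
def auctionTime (n m : ℕ) : ℕ := m * ((n + 1) * n + 1) * (11 * m + 6 * n + 29) + 4

theorem within_auction (hnm : n ≤ m) (h : Loaded n m p x s) (h₈ : s.reg 8 = 0)
    (h₅ : ∀ i, s.arr 5 i = 0) (h₄ : ∀ i, s.arr 4 i = 0) :
    Within auction (auctionTime n m) s fun s' => AuctionState n m ((n + 1) * n)
      (scaledCost n m p x) (s'.arr 1) (s'.arr 5) (s'.arr 4) (Finset.range n) := by
  refine (Within.seq (T := 2)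
    (T' := m * ((n + 1) * n + 1) * (11 * m + 6 * n + 29) + 1) ?_).of_le
    (by rw [auctionTime]; omega)
  refine within_activate h.reg_one (by omega) fun cur hcur => ?_
  rw [h₈] at hcur
  have h' : Loaded n m p x { s with reg := Function.update s.reg 6 cur } :=
    ⟨h.reg_one, h.reg_two, h.input, h.row, h.pref⟩
  -- All prices start at `0`, so the initial budget is the full cap on their sum.
  refine Within.loop (AuctionInvariant n m p x) ⟨∅, AuctionState.init h₅ h₄, ?_, ?_⟩ ?_ ?_
  · simpa [h₈] using hcur
  · simp [h₄]
  · intro k s' hf hJ he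
    exact within_bid hnm
      (h'.frame hf (by decide) (by decide) (by decide) (by decide) (by decide)) hJ he
  · rintro k s' hf ⟨A, hS, hP, -⟩ he
    obtain rfl := hP.1 he
    exact hS

/-- Output an assignment of minimum cost. -/
def main : Prog := .seq load (.seq auction (.set 0 (.reg 1)))

/-- A time bound for the program. -/
def time (n m : ℕ) : ℕ := 10 * n + 3 * m + n * (3 * m + 11) + auctionTime n m + 12

theorem within_main (hnm : n ≤ m) (hx : Encodes n m p x) (hr : ∀ r, r ≠ 0 → s.reg r = 0)
    (h₀ : s.arr 0 = x) (ha : ∀ a, a ≠ 0 → ∀ i, s.arr a i = 0) :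
    Within main (time n m) s fun s' => ∃ f : ℕ → ℕ, output s' = (List.range n).map f ∧
      (∀ a < n, f a < m) ∧ Set.InjOn f (Finset.range n) ∧
      ∀ ψ : ℕ → ℕ, (∀ a < n, ψ a < m) → Set.InjOn ψ (Finset.range n) →
        ∑ a ∈ Finset.range n, demand n m p x a (f a) ≤
          ∑ a ∈ Finset.range n, demand n m p x a (ψ a) := by
  refine (Within.seq (T := 10 * n + 3 * m + n * (3 * m + 11) + 9) (T' := auctionTime n m + 2)
    ?_).of_le (by rw [time]; omega)
  refine (within_load hx hr h₀).conseq le_rfl fun s₁ hf₁ l₁ => ?_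
  refine Within.seq (T := auctionTime n m) (T' := 1) ?_
  refine (within_auction hnm l₁ ((hf₁.1 8 (by decide)).trans (hr 8 (by decide)))
    (fun i => by rw [hf₁.2 5 (by decide), ha 5 (by decide)])
    (fun i => by rw [hf₁.2 4 (by decide), ha 4 (by decide)])).conseq le_rfl fun s₂ hf₂ hS => ?_
  have h₁ : s₂.reg 1 = n := (hf₂.1 1 (by decide)).trans l₁.reg_one
  refine Within.set ⟨s₂.arr 1, ?_, fun a ha => hS.asg_lt a (Finset.mem_range.2 ha), hS.injOn,
    fun ψ hψ hinj => hS.sum_asg_le_of_scaled hψ hinj⟩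
  simp [output, Expr.eval, h₁]

end HouseProgram

/-! ### The input word as memory content. -/

theorem List.getD_flatMap_of_length {α β : Type*} {g : α → List β} {k : ℕ}
    (hg : ∀ x, (g x).length = k) {l : List α} {a b : ℕ} (ha : a < l.length) (hb : b < k) (d : β) :
    (l.flatMap g).getD (a * k + b) d = (g l[a]).getD b d := by
  induction l generalizing a with
  | nil => simp at ha
  | cons y l ih =>
    rw [List.flatMap_cons]
    cases a with
    | zero => rw [List.getD_append _ _ _ _ (by rw [hg]; omega)]; simp
    | succ a =>
      rw [List.getD_append_right _ _ _ _ (by rw [hg, add_mul]; omega), hg,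
        show (a + 1) * k + b - k = a * k + b by rw [add_mul]; omega,
        ih (by simpa using ha)]
      simp

theorem List.length_flatMap_of_length {α β : Type*} {g : α → List β} {k : ℕ}
    (hg : ∀ x, (g x).length = k) (l : List α) : (l.flatMap g).length = l.length * k := by
  simp [List.length_flatMap, hg]

namespace HouseInstance

variable (I : HouseInstance)

/-- The content of the input array on the code of `I`. -/
noncomputable def input (i : ℕ) : ℕ := (I.code.getD i false).toNat

theorem length_code : I.code.length = I.n + 1 + I.m + 1 + I.n * I.n + I.n * I.m := by
  simp [code]
  omega

/-- The right-nested form lets lookups strip off the prefixes one at a time. -/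
theorem code_eq : ∃ G H : List Bool,
    I.code = List.replicate I.n true ++
      (false :: (List.replicate I.m true ++ (false :: (G ++ H)))) ∧
    G.length = I.n * I.n ∧
    (∀ a b : Fin I.n, G.getD (a * I.n + b) false = true ↔ I.graph.Adj a b) ∧
    ∀ (a : Fin I.n) (h : Fin I.m), H.getD (a * I.m + h) false = true ↔ h ∈ I.pref a := by
  classical
  refine ⟨(List.finRange I.n).flatMap fun a =>
      (List.finRange I.n).map fun b => decide (I.graph.Adj a b),
    (List.finRange I.n).flatMap fun a => (List.finRange I.m).map fun h => decide (h ∈ I.pref a),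
    by simp only [code, List.append_assoc, List.cons_append, List.nil_append], ?_, fun a b => ?_, fun a h => ?_⟩
  · rw [List.length_flatMap_of_length (k := I.n) (by simp)]
    simp
  · rw [List.getD_flatMap_of_length (k := I.n) (by simp) (by simp) b.2]
    simp
  · rw [List.getD_flatMap_of_length (k := I.m) (by simp) (by simp) h.2]
    simp

theorem input_adj (a b : Fin I.n) :
    I.input (I.n + I.m + 2 + a * I.n + b) ≠ 0 ↔ I.graph.Adj a b := by
  obtain ⟨G, H, hc, hG, hadj, -⟩ := I.code_eq
  have hlt : (a : ℕ) * I.n + b < I.n * I.n := by nlinarith [a.2, b.2]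
  rw [← hadj, input, hc, List.getD_append_right _ _ _ _ (by simp; omega),
    show I.n + I.m + 2 + a * I.n + b - (List.replicate I.n true).length =
      I.m + (a * I.n + b + 1) + 1 by simp; omega, List.getD_cons_succ,
    List.getD_append_right _ _ _ _ (by simp),
    show I.m + (a * I.n + b + 1) - (List.replicate I.m true).length = a * I.n + b + 1 by simp,
    List.getD_cons_succ, List.getD_append _ _ _ _ (by omega)]
  simp

theorem input_pref (a : Fin I.n) (h : Fin I.m) :
    I.input (I.n + I.m + 2 + I.n * I.n + a * I.m + h) ≠ 0 ↔ h ∈ I.pref a := by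
  obtain ⟨G, H, hc, hG, -, hp⟩ := I.code_eq
  rw [← hp, input, hc, List.getD_append_right _ _ _ _ (by simp; omega),
    show I.n + I.m + 2 + I.n * I.n + a * I.m + h - (List.replicate I.n true).length =
      I.m + (I.n * I.n + (a * I.m + h) + 1) + 1 by simp; omega, List.getD_cons_succ,
    List.getD_append_right _ _ _ _ (by simp),
    show I.m + (I.n * I.n + (a * I.m + h) + 1) - (List.replicate I.m true).length =
      I.n * I.n + (a * I.m + h) + 1 by simp,
    List.getD_cons_succ, List.getD_append_right _ _ _ _ (by omega), hG, Nat.add_sub_cancel_left]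
  simp

/-- A function on the agents, extended by `0`. -/
def extend {I : HouseInstance} (f : Fin I.n → Fin I.m) (b : ℕ) : ℕ :=
  if h : b < I.n then f ⟨b, h⟩ else 0

variable {I} {P : Fin I.n → Fin I.m}

@[simp]
theorem extend_val (f : Fin I.n → Fin I.m) (b : Fin I.n) : extend f b = f b := by
  simp [extend]

theorem encodes (hP : ∀ a, I.pref a = {P a}) :
    HouseProgram.Encodes I.n I.m (extend P) I.input := by
  obtain ⟨G, H, hc, -, -, -⟩ := I.code_eq
  refine ⟨fun i hi => ?_, ?_, fun j hj => ?_, ?_, fun b hb => ?_, fun b hb h hh => ?_⟩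
  · rw [input, hc, List.getD_append _ _ _ _ (by simpa using hi), List.getD_replicate _ hi]
    decide
  · rw [input, hc, List.getD_append_right _ _ _ _ (by simp)]
    simp
  · rw [input, hc, List.getD_append_right _ _ _ _ (by simp; omega),
      show I.n + j + 1 - (List.replicate I.n true).length = j + 1 by simp; omega,
      List.getD_cons_succ, List.getD_append _ _ _ _ (by simpa using hj), List.getD_replicate _ hj]
    decide
  · rw [input, hc, List.getD_append_right _ _ _ _ (by simp; omega),
      show I.n + I.m + 1 - (List.replicate I.n true).length = I.m + 1 by simp; omega,
      List.getD_cons_succ, List.getD_append_right _ _ _ _ (by simp)]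
    simp
  · simp [extend, hb]
  · rw [I.input_pref ⟨b, hb⟩ ⟨h, hh⟩, hP, Finset.mem_singleton, extend_val P ⟨b, hb⟩, Fin.ext_iff]

theorem demand_eq_weight (hP : ∀ a, I.pref a = {P a}) (a : Fin I.n) (h : Fin I.m) :
    HouseProgram.demand I.n I.m (extend P) I.input a h = I.weight a h := by
  classical
  rw [HouseProgram.demand, weight, Finset.card_filter, Finset.card_filter, Finset.sum_range]
  refine Finset.sum_congr rfl fun b _ => ?_
  simp only [input_adj, extend_val, hP, Finset.singleton_inj, Fin.ext_iff]

theorem sum_demand_eq_envy (hI : ∀ a, (I.pref a).card = 1) (hP : ∀ a, I.pref a = {P a})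
    (φ : I.Allocation) {f : ℕ → ℕ} (hf : ∀ a : Fin I.n, f a = φ a) :
    ∑ a ∈ Finset.range I.n, HouseProgram.demand I.n I.m (extend P) I.input a (f a) =
      I.envy φ := by
  rw [Finset.sum_range, ← sum_weight_eq_envy hI]
  exact Finset.sum_congr rfl fun a _ => by rw [hf, demand_eq_weight hP]

end HouseInstance

/-! ### Correctness and polynomial running time. -/

open RAM in
theorem HouseProgram.outputsWithin {I : HouseInstance} (hnm : I.n ≤ I.m)
    (hI : ∀ a, (I.pref a).card = 1) :
    ∃ out, OutputsWithin main I.code (time I.n I.m) out ∧ I.IsSolution out := by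
  choose P hP using fun a => Finset.card_eq_one.1 (hI a)
  obtain ⟨t, ht, s, hs, -, f, hout, hfm, hinj, hmin⟩ :=
    within_main (s := initStore I.code) hnm (HouseInstance.encodes hP)
      (fun r hr => by simp [initStore, hr]) rfl (fun a ha i => by simp [initStore, ha])
  refine ⟨output s, ⟨t, ht, s, hs [], rfl⟩, ⟨fun a => ⟨f a, hfm a a.2⟩, fun a b hab => ?_⟩,
    fun ψ => ?_, ?_⟩
  · exact Fin.ext (hinj (by simp) (by simp) (Fin.ext_iff.1 hab))
  -- Both envies become total demands, so optimality among injective functions on `{0, …, n - 1}`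
  -- applies to the extension of `ψ`.
  · rw [← HouseInstance.sum_demand_eq_envy hI hP _ (f := f) fun _ => rfl,
      ← HouseInstance.sum_demand_eq_envy hI hP ψ (HouseInstance.extend_val ψ)]
    refine hmin _ (fun a ha => ?_) fun a ha b hb hab => ?_
    · simp [HouseInstance.extend, ha]
    · lift a to Fin I.n using by simpa using ha
      lift b to Fin I.n using by simpa using hb
      rw [HouseInstance.extend_val, HouseInstance.extend_val] at hab
      exact congrArg _ (ψ.injective (Fin.ext hab))
  · rw [hout]
    exact List.ext_getElem (by simp) fun i _ _ => by simp; rfl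

theorem HouseProgram.time_mono {n m n' m' : ℕ} (hn : n ≤ n') (hm : m ≤ m') :
    time n m ≤ time n' m' := by
  unfold time auctionTime
  gcongr

/-- Both `n` and `m` are at most the input length `k`, so by `time_mono` a single polynomial for
`time k k` suffices. -/
theorem HouseProgram.exists_polynomial_eval_eq_time :
    ∃ p : Polynomial ℕ, ∀ k, p.eval k = time k k := by
  open Polynomial in
  exact ⟨10 * X + 3 * X + X * (3 * X + 11) +
    (X * ((X + 1) * X + 1) * (11 * X + 6 * X + 29) + 4) + 12, fun k => by
      simp [time, auctionTime]⟩

theorem theorem3p1 :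
    RAM.PolyTimeSolvable HouseInstance.code
      (fun I => I.n ≤ I.m ∧ ∀ a : Fin I.n, (I.pref a).card = 1)
      HouseInstance.IsSolution ∧
    ∀ I : HouseInstance, I.n ≤ I.m → (∀ a : Fin I.n, (I.pref a).card = 1) →
      (∀ φ : I.Allocation,
        I.IsMaxMatching (I.matchingOf φ) ∧ I.cost (I.matchingOf φ) = I.envy φ) ∧
      ∀ M : I.bip.Subgraph,
        I.IsMinCostMaxMatching M ↔ ∃ φ : I.Allocation, I.IsMinEnvy φ ∧ M = I.matchingOf φ := by
  refine ⟨?_, fun I hnm hI => ⟨fun φ => ⟨HouseInstance.matchingOf_isMaxMatching φ,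
    (HouseInstance.cost_matchingOf φ).trans (HouseInstance.sum_weight_eq_envy hI φ)⟩,
    HouseInstance.isMinCostMaxMatching_iff hnm hI⟩⟩
  obtain ⟨p, hp⟩ := HouseProgram.exists_polynomial_eval_eq_time
  refine ⟨HouseProgram.main, p, fun I hI => ?_⟩
  obtain ⟨out, ⟨t, ht, hs⟩, hsol⟩ := HouseProgram.outputsWithin hI.1 hI.2
  refine ⟨out, ⟨t, ht.trans ?_, hs⟩, hsol⟩
  rw [hp, I.length_code]
  exact HouseProgram.time_mono (by omega) (by omega)
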